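/- For a real function $f$ on $\mathbb R^2$ put $\nabla^\perp f=(-\partial_2 f,\partial_1 f)$, and for $\boldsymbol h=(h^1,h^2,h^3)$ put $\boldsymbol h'=(h^1,h^2)$. Let $\hat W^{m,2}(\mathbb R^2)$ be the space of all $f\in W^{m,2}_{\rm loc}(\mathbb R^2)$ whose weak derivatives $D^\alpha f$ with $|\alpha|=m$ belong to $L^2(\mathbb R^2)$. For $\boldsymbol h\in L^2(\mathbb R^2;\mathbb R^3)$, a pair $(\Phi,\Psi)\in\hat W^{2,2}(\mathbb R^2)\times\hat W^{1,2}(\mathbb R^2)$ is called a strong-weak solution of the $\Phi$-$\Psi$ system $$\Delta\Phi=\nabla^\perp\Psi\cdot\nabla\Phi+h^3,\qquad \Delta\Psi=-\nabla^\perp\Delta\Phi\cdot\nabla\Phi+\partial_1h^2-\partial_2h^1$$ if the first equation holds almost everywhere in $\mathbb R^2$ and the second holds in the sense of distributions, i.e. for every $\varphi\in C_c^\infty(\mathbb R^2)$, $$\int_{\mathbb R^2}\nabla\Psi\cdot\nabla\varphi=\int_{\mathbb R^2}\bigl(-\Delta\Phi\,\nabla\Phi\cdot\nabla^\perp\varphi+\boldsymbol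 h'\cdot\nabla^\perp\varphi\bigr).$$ **Lemma 8.1.** Let $\boldsymbol h\in L^2(\mathbb R^2;\mathbb R^3)$ and let $(\Phi,\Psi)\in\hat W^{2,2}(\mathbb R^2)\times\hat W^{1,2}(\mathbb R^2)$ be a strong-weak solution of the $\Phi$-$\Psi$ system. Then for all $\zeta\in C_c^\infty(\mathbb R^2)$ and all $c\in\mathbb R$, the function $(\Psi-c)\zeta$ belongs to $\hat W^{1,2}(\mathbb R^2)$, the three integrands below are integrable, and $$\int_{\mathbb R^2}\bigl((\Delta\Phi)^2+|\nabla\Psi|^2\bigr)\zeta=-\int_{\mathbb R^2}\Bigl((\Psi-c)\nabla\Psi-(\Psi-c)\,\Delta\Phi\,\nabla^\perp\Phi\Bigr)\cdot\nabla\zeta+\int_{\mathbb R^2}\Bigl(h^3\,\Delta\Phi\,\zeta+\boldsymbol h'\cdot\nabla^\perp\bigl((\Psi-c)\zeta\bigr)\Bigr).$$ -/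

import Mathlib

open MeasureTheory
open scoped ContDiff ENNReal RealInnerProductSpace Gradient

noncomputable section

namespace HallMHD

/-- The Euclidean plane `ℝ²`; the coordinates `x₁, x₂` are `x 0, x 1`. -/
abbrev Plane := EuclideanSpace ℝ (Fin 2)

/-- Test functions: the class `C_c^∞(ℝ²)`. -/
def IsTestFunction (φ : Plane → ℝ) : Prop :=
  ContDiff ℝ ∞ φ ∧ HasCompactSupport φ

/-- The classical iterated partial derivative: for `α = [i₁, …, i_k]` this is
`∂_{i₁} ⋯ ∂_{i_k} φ`, an operator of order `|α| = k`. Every multi-index arises in this way. -/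
def classicalDeriv : List (Fin 2) → (Plane → ℝ) → Plane → ℝ
  | [], φ => φ
  | i :: l, φ => fun x => fderiv ℝ (classicalDeriv l φ) x (EuclideanSpace.single i 1)

/-- `g` is the weak (distributional) derivative `D^α f`, where `α` is a list of directions. -/
structure IsWeakDeriv (α : List (Fin 2)) (f g : Plane → ℝ) : Prop where
  locallyIntegrable_left : LocallyIntegrable f
  locallyIntegrable_right : LocallyIntegrable g
  integral_eq : ∀ φ : Plane → ℝ, IsTestFunction φ →
    ∫ x, f x * classicalDeriv α φ x = (-1) ^ α.length * ∫ x, g x * φ x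

open Classical in
/-- A representative of the weak derivative `D^α f` (which is unique up to null sets);
by convention it is `0` if `f` has no such weak derivative. -/
def weakDeriv (α : List (Fin 2)) (f : Plane → ℝ) : Plane → ℝ :=
  if h : ∃ g, IsWeakDeriv α f g then h.choose else 0

/-- The space `L^s_loc(ℝ²)`. -/
def MemLpLoc (s : ℝ≥0∞) (f : Plane → ℝ) : Prop :=
  ∀ K : Set Plane, IsCompact K → MemLp f s (volume.restrict K)

/-- The space `W^{m,s}_loc(ℝ²)`: all weak derivatives of order at most `m` (the function itself
included) exist and belong to `L^s_loc`. -/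
def MemWLoc (m : ℕ) (s : ℝ≥0∞) (f : Plane → ℝ) : Prop :=
  MemLpLoc s f ∧
    ∀ α : List (Fin 2), α.length ≤ m → ∃ g, IsWeakDeriv α f g ∧ MemLpLoc s g

/-- The space `Ŵ^{m,2}(ℝ²)`: functions in `W^{m,2}_loc(ℝ²)` all of whose weak derivatives of
order exactly `m` belong to `L²(ℝ²)`. -/
def MemWHat (m : ℕ) (f : Plane → ℝ) : Prop :=
  MemWLoc m 2 f ∧ ∀ α : List (Fin 2), α.length = m → MemLp (weakDeriv α f) 2 volume

/-- The weak gradient `(∂₁ f, ∂₂ f)`. -/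
def weakGrad (f : Plane → ℝ) (x : Plane) : Plane :=
  !₂[weakDeriv [0] f x, weakDeriv [1] f x]

/-- The weak Laplacian `∂₁∂₁ f + ∂₂∂₂ f`. -/
def weakLaplacian (f : Plane → ℝ) (x : Plane) : ℝ :=
  weakDeriv [0, 0] f x + weakDeriv [1, 1] f x

/-- The rotation `(a, b) ↦ (-b, a)`, so that `∇^⊥ f = (-∂₂ f, ∂₁ f)` is `perp` of `∇ f`. -/
def perp (v : Plane) : Plane := !₂[-v 1, v 0]

/-- The first two components `w' = (w¹, w²)` of `w = (w¹, w², w³)`. -/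
def prime (w : EuclideanSpace ℝ (Fin 3)) : Plane := !₂[w 0, w 1]

/-- `(Φ, Ψ) ∈ Ŵ^{2,2}(ℝ²) × Ŵ^{1,2}(ℝ²)` is a strong-weak solution of the `Φ`-`Ψ` system
`ΔΦ = ∇^⊥Ψ · ∇Φ + h³`, `ΔΨ = -∇^⊥ΔΦ · ∇Φ + ∂₁h² - ∂₂h¹`: the first equation holds almost
everywhere, the second one in the sense of distributions. -/
structure IsStrongWeakSolution (h : Plane → EuclideanSpace ℝ (Fin 3)) (Φ Ψ : Plane → ℝ) :
    Prop where
  mem_left : MemWHat 2 Φ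
  mem_right : MemWHat 1 Ψ
  strong : ∀ᵐ x, weakLaplacian Φ x = ⟪perp (weakGrad Ψ x), weakGrad Φ x⟫ + h x 2
  weak : ∀ φ : Plane → ℝ, IsTestFunction φ →
    ∫ x, ⟪weakGrad Ψ x, ∇ φ x⟫ =
      ∫ x, (-weakLaplacian Φ x * ⟪weakGrad Φ x, perp (∇ φ x)⟫
        + ⟪prime (h x), perp (∇ φ x)⟫)

end HallMHD

end

open HallMHD

open HallMHD

open Filter Topology Convolution

/-! The identity results from testing the second equation with `f = (Ψ - c) ζ` and using the first
to rewrite `∇^⊥Ψ · ∇Φ` as `ΔΦ - h³`. The difficulty is that `f` is only a compactly supported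
`W^{1,2}` function, while `∇Φ` lies in `W^{1,2}_loc`, which in the plane does not give boundedness,
so `ΔΦ ∇Φ · ∇^⊥f` is not obviously integrable.

The first equation supplies the missing integrability: almost everywhere `∇Φ · ∇^⊥f = (ΔΦ - h³) ζ +
(Ψ - c) ∇Φ · ∇^⊥ζ`. The first summand is in `L²` by assumption. The second is so because, in
dimension two, a product of two `W^{1,2}` functions, one of compact support, is in `L²` by the
Sobolev embedding of `W^{1,1}` (`memLp_mul_of_isWeakDeriv`).

To justify the test function, `f` is mollified. With `b = ∂_jΦ` and `g = ∂_i f`, the products `b g`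
need not be in `L²` separately, but the commutator `b (g * ρ_n) - (b g) * ρ_n` tends to `0` in `L²`
(`tendsto_commutator`), because `∇b` and `g` are in `L²`. Hence the mollified cross terms converge
in `L²` once their formal limit is in `L²`, and the weak equation passes to the limit. -/

/-! ### Square integrals and Cauchy–Schwarz. -/

theorem eLpNorm_two_sq {X F : Type*} [MeasurableSpace X] [NormedAddCommGroup F] (μ : Measure X)
    (f : X → F) : eLpNorm f 2 μ ^ 2 = ∫⁻ x, ‖f x‖ₑ ^ 2 ∂μ := by
  have := eLpNorm_nnreal_pow_eq_lintegral (f := f) (μ := μ) (p := 2) (by norm_num)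
  norm_num at this
  exact_mod_cast this

theorem memLp_two_iff {X F : Type*} [MeasurableSpace X] [NormedAddCommGroup F] {μ : Measure X}
    {f : X → F} :
    MemLp f 2 μ ↔ AEStronglyMeasurable f μ ∧ ∫⁻ x, ‖f x‖ₑ ^ 2 ∂μ < ⊤ := by
  rw [← eLpNorm_two_sq, MemLp]
  simp

theorem tendsto_eLpNorm_two_zero_iff {X F ι : Type*} [MeasurableSpace X] [NormedAddCommGroup F]
    {μ : Measure X} {f : ι → X → F} {l : Filter ι} :
    Tendsto (fun n => eLpNorm (f n) 2 μ) l (𝓝 0) ↔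
      Tendsto (fun n => ∫⁻ x, ‖f n x‖ₑ ^ 2 ∂μ) l (𝓝 0) := by
  simp_rw [← eLpNorm_two_sq]
  refine ⟨fun h => ?_, fun h => ?_⟩
  · simpa using ENNReal.Tendsto.pow h (n := 2)
  · have := h.ennrpow_const (1 / 2 : ℝ)
    have e : ∀ a : ℝ≥0∞, (a ^ 2) ^ (1 / 2 : ℝ) = a := fun a => by
      rw [← ENNReal.rpow_natCast, ← ENNReal.rpow_mul]; norm_num
    simp only [e, ENNReal.zero_rpow_of_pos (show (0 : ℝ) < 1 / 2 by norm_num)] at this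
    exact this

theorem sq_lintegral_mul_le {X : Type*} [MeasurableSpace X] (μ : Measure X) {f g : X → ℝ≥0∞}
    (hf : AEMeasurable f μ) (hg : AEMeasurable g μ) :
    (∫⁻ x, f x * g x ∂μ) ^ 2 ≤ (∫⁻ x, f x ^ 2 ∂μ) * ∫⁻ x, g x ^ 2 ∂μ := by
  have h := ENNReal.lintegral_mul_le_Lp_mul_Lq μ (Real.HolderConjugate.two_two) hf hg
  have e : ∀ a : ℝ≥0∞, (a ^ (1 / 2 : ℝ)) ^ 2 = a := fun a => by
    rw [← ENNReal.rpow_natCast, ← ENNReal.rpow_mul]; norm_num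
  calc _ ≤ _ := pow_le_pow_left' h 2
    _ = _ := by rw [mul_pow, e, e]; norm_cast

theorem sq_lintegral_le {X : Type*} [MeasurableSpace X] (μ : Measure X) [IsProbabilityMeasure μ]
    {f : X → ℝ≥0∞} (hf : AEMeasurable f μ) :
    (∫⁻ x, f x ∂μ) ^ 2 ≤ ∫⁻ x, f x ^ 2 ∂μ := by
  simpa using sq_lintegral_mul_le μ hf (aemeasurable_const (b := (1 : ℝ≥0∞)))

/-- Cauchy–Schwarz in `y`, where `ν` has mass one, followed by Tonelli. All `L²` bounds for averages
over translations rest on this. -/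
theorem lintegral_sq_integral_le {X Y : Type*} [MeasurableSpace X] [MeasurableSpace Y]
    (μ : Measure X) [SFinite μ] (ν : Measure Y) [IsProbabilityMeasure ν] {F : X × Y → ℝ}
    (hF : AEStronglyMeasurable F (μ.prod ν)) :
    ∫⁻ x, ‖∫ y, F (x, y) ∂ν‖ₑ ^ 2 ∂μ ≤ ∫⁻ y, ∫⁻ x, ‖F (x, y)‖ₑ ^ 2 ∂μ ∂ν := by
  rw [← lintegral_lintegral_swap (f := fun x y => ‖F (x, y)‖ₑ ^ 2) (hF.enorm.pow_const 2)]
  refine lintegral_mono_ae ?_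
  filter_upwards [hF.prodMk_left] with x hx
  exact (pow_le_pow_left' (enorm_integral_le_lintegral_enorm _) 2).trans
    (sq_lintegral_le ν hx.enorm)

theorem enorm_add_sq_le (a b : ℝ) : ‖a + b‖ₑ ^ 2 ≤ 2 * ‖a‖ₑ ^ 2 + 2 * ‖b‖ₑ ^ 2 := by
  have e : ∀ t : ℝ, ‖t‖ₑ ^ 2 = ENNReal.ofReal (t ^ 2) := fun t => by
    rw [← ofReal_norm, ← ENNReal.ofReal_pow (norm_nonneg t), Real.norm_eq_abs, sq_abs]
  rw [e, e, e, show (2 : ℝ≥0∞) = ENNReal.ofReal 2 by simp, ← ENNReal.ofReal_mul (by norm_num),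
    ← ENNReal.ofReal_mul (by norm_num), ← ENNReal.ofReal_add (by positivity) (by positivity)]
  exact ENNReal.ofReal_le_ofReal (by nlinarith [sq_nonneg (a - b)])

/-! ### Mollification. -/

/-- The standard bump function at the scale `1 / (n + 1)`. -/
noncomputable def bump (n : ℕ) : ContDiffBump (0 : Plane) where
  rIn := 1 / (2 * (n + 1))
  rOut := 1 / (n + 1)
  rIn_pos := by positivity
  rIn_lt_rOut := by
    apply one_div_lt_one_div_of_lt <;> linarith [Nat.cast_nonneg (α := ℝ) n]

theorem bump_rOut (n : ℕ) : (bump n).rOut = 1 / ((n : ℝ) + 1) := rfl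

theorem bump_rOut_tendsto : Tendsto (fun n => (bump n).rOut) atTop (𝓝 0) :=
  tendsto_one_div_add_atTop_nhds_zero_nat

/-- A fixed ratio of the radii is what both the almost everywhere convergence and the pointwise
bound on the mollifier require. -/
theorem bump_rOut_eq (n : ℕ) : (bump n).rOut = 2 * (bump n).rIn := by
  simp only [bump]; field_simp

/-- The mollifier at the scale `1 / (n + 1)`. -/
noncomputable def mollifier (n : ℕ) : Plane → ℝ := (bump n).normed volume

/-- The probability measure with density `mollifier n`. -/
noncomputable def mollMeasure (n : ℕ) : Measure Plane :=
  volume.withDensity (fun y => ENNReal.ofReal (mollifier n y))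

/-- The mollification of `f` at the scale `1 / (n + 1)`. -/
noncomputable def mollify (n : ℕ) (f : Plane → ℝ) (x : Plane) : ℝ :=
  ∫ y, f (x - y) ∂(mollMeasure n)

theorem mollifier_nonneg (n : ℕ) (y : Plane) : 0 ≤ mollifier n y := (bump n).nonneg_normed y

theorem mollifier_contDiff (n : ℕ) : ContDiff ℝ ∞ (mollifier n) := (bump n).contDiff_normed

theorem mollifier_hasCompactSupport (n : ℕ) : HasCompactSupport (mollifier n) :=
  (bump n).hasCompactSupport_normed

theorem measurable_mollifier (n : ℕ) : Measurable (mollifier n) :=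
  (mollifier_contDiff n).continuous.measurable

instance (n : ℕ) : IsProbabilityMeasure (mollMeasure n) := by
  constructor
  rw [mollMeasure, withDensity_apply _ MeasurableSet.univ, Measure.restrict_univ,
    ← ofReal_integral_eq_lintegral_ofReal (f := mollifier n) (bump n).integrable_normed
      (ae_of_all _ (mollifier_nonneg n))]
  simp [mollifier, (bump n).integral_normed]

theorem mollMeasure_absolutelyContinuous (n : ℕ) : mollMeasure n ≪ volume :=
  withDensity_absolutelyContinuous _ _

theorem mollify_eq_integral (n : ℕ) (f : Plane → ℝ) (x : Plane) :
    mollify n f x = ∫ y, mollifier n y * f (x - y) := by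
  rw [mollify, mollMeasure, integral_withDensity_eq_integral_toReal_smul
    (measurable_mollifier n).ennreal_ofReal (ae_of_all _ fun _ => ENNReal.ofReal_lt_top)]
  simp [mollifier_nonneg]

theorem mollify_eq_convolution (n : ℕ) (f : Plane → ℝ) :
    mollify n f = (mollifier n ⋆[ContinuousLinearMap.lsmul ℝ ℝ, volume] f) := by
  ext x
  simp [mollify_eq_integral, convolution_def]

theorem integrable_mollMeasure (n : ℕ) {f : Plane → ℝ} (hf : LocallyIntegrable f) (x : Plane) :
    Integrable (fun y => f (x - y)) (mollMeasure n) := by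
  rw [mollMeasure, integrable_withDensity_iff_integrable_smul'
    (measurable_mollifier n).ennreal_ofReal (ae_of_all _ fun _ => ENNReal.ofReal_lt_top)]
  have := (mollifier_hasCompactSupport n).convolutionExists_left
    (ContinuousLinearMap.lsmul ℝ ℝ) (mollifier_contDiff n).continuous hf x
  simpa [ConvolutionExistsAt, mollifier_nonneg] using this

theorem mollify_contDiff (n : ℕ) {f : Plane → ℝ} (hf : LocallyIntegrable f) :
    ContDiff ℝ ∞ (mollify n f) := by
  rw [mollify_eq_convolution]
  exact (mollifier_hasCompactSupport n).contDiff_convolution_left _ (mollifier_contDiff n) hf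

theorem mollify_hasCompactSupport (n : ℕ) {f : Plane → ℝ} (hf : HasCompactSupport f) :
    HasCompactSupport (mollify n f) := by
  rw [mollify_eq_convolution]
  exact HasCompactSupport.convolution _ (mollifier_hasCompactSupport n) hf

theorem mollify_ae_tendsto {f : Plane → ℝ} (hf : LocallyIntegrable f) :
    ∀ᵐ x, Tendsto (fun n => mollify n f x) atTop (𝓝 (f x)) := by
  have := ContDiffBump.ae_convolution_tendsto_right_of_locallyIntegrable (μ := volume)
    (φ := bump) (l := atTop) (K := 2) bump_rOut_tendsto
    (Eventually.of_forall fun n => (bump_rOut_eq n).le) hf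
  simpa only [mollify_eq_convolution, mollifier] using this

theorem aestronglyMeasurable_sub_prod {f : Plane → ℝ} (hf : AEStronglyMeasurable f)
    {ν : Measure Plane} [SFinite ν] (hν : ν ≪ volume) :
    AEStronglyMeasurable (fun z : Plane × Plane => f (z.1 - z.2)) (volume.prod ν) :=
  (hf.comp_quasiMeasurePreserving (quasiMeasurePreserving_sub volume volume)).mono_ac
    (Measure.AbsolutelyContinuous.rfl.prod hν)

theorem aestronglyMeasurable_sub_left {f : Plane → ℝ} (hf : AEStronglyMeasurable f)
    {ν : Measure Plane} (hν : ν ≪ volume) (x : Plane) :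
    AEStronglyMeasurable (fun y => f (x - y)) ν :=
  (hf.comp_quasiMeasurePreserving (quasiMeasurePreserving_sub_left volume x)).mono_ac hν

theorem aestronglyMeasurable_mollify (n : ℕ) {f : Plane → ℝ} (hf : AEStronglyMeasurable f) :
    AEStronglyMeasurable (mollify n f) volume :=
  (aestronglyMeasurable_sub_prod hf (mollMeasure_absolutelyContinuous n)).integral_prod_right'

/-- A mollification is an average of translates, all of which have the same `L²` norm. -/
theorem lintegral_sq_mollify_le (n : ℕ) {f : Plane → ℝ} (hf : AEStronglyMeasurable f) :
    ∫⁻ x, ‖mollify n f x‖ₑ ^ 2 ≤ ∫⁻ x, ‖f x‖ₑ ^ 2 := by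
  refine (lintegral_sq_integral_le volume (mollMeasure n)
    (aestronglyMeasurable_sub_prod hf (mollMeasure_absolutelyContinuous n))).trans ?_
  simp only [lintegral_sub_right_eq_self (fun x => ‖f x‖ₑ ^ 2)]
  simp

theorem memLp_mollify (n : ℕ) {f : Plane → ℝ} (hf : MemLp f 2) : MemLp (mollify n f) 2 := by
  rw [memLp_two_iff] at *
  exact ⟨aestronglyMeasurable_mollify n hf.1, (lintegral_sq_mollify_le n hf.1).trans_lt hf.2⟩

theorem mollMeasure_ae_mem (n : ℕ) : ∀ᵐ y ∂(mollMeasure n), ‖y‖ < 1 / ((n : ℝ) + 1) := by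
  rw [mollMeasure, ae_withDensity_iff (measurable_mollifier n).ennreal_ofReal]
  refine ae_of_all _ fun y hy => ?_
  have : y ∈ Function.support ((bump n).normed volume) := by
    intro h0
    exact hy (by simp [mollifier, h0])
  rw [(bump n).support_normed_eq] at this
  simpa [bump_rOut] using this

/-- The translations form a continuous family of measure-preserving maps, and composition in `L²` is
continuous along such a family. -/
theorem tendsto_eLpNorm_translate_sub {f : Plane → ℝ} (hf : MemLp f 2) :
    Tendsto (fun y : Plane => eLpNorm (fun x => f (x - y) - f x) 2 volume) (𝓝 0) (𝓝 0) := by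
  let T : C(Plane, C(Plane, Plane)) :=
    ContinuousMap.curry ⟨fun z : Plane × Plane => z.2 - z.1, by fun_prop⟩
  have hT : ∀ y, MeasurePreserving (T y) volume volume := fun y =>
    measurePreserving_sub_right volume y
  have h := Filter.Tendsto.compMeasurePreservingLp (p := 2) (f := fun _ : Plane => hf.toLp f)
    (g := T) tendsto_const_nhds (T.continuous.tendsto 0) hT (hT 0) (by norm_num)
  rw [tendsto_iff_edist_tendsto_0] at h
  refine h.congr fun y => ?_
  rw [Lp.toLp_compMeasurePreserving, Lp.toLp_compMeasurePreserving, Lp.edist_toLp_toLp]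
  congr 1
  ext x
  simp [T]

/-- The mollification error is an average of `f (x - y) - f x` over `‖y‖ < 1 / (n + 1)`, so
continuity of translations in `L²` controls it. -/
theorem tendsto_lintegral_sq_mollify_sub {f : Plane → ℝ} (hf : MemLp f 2) :
    Tendsto (fun n => ∫⁻ x, ‖mollify n f x - f x‖ₑ ^ 2) atTop (𝓝 0) := by
  have h1 := tendsto_eLpNorm_two_zero_iff.1 (tendsto_eLpNorm_translate_sub hf)
  rw [ENNReal.tendsto_nhds_zero] at h1 ⊢
  intro ε hε
  obtain ⟨δ, hδ, H⟩ := Metric.eventually_nhds_iff.1 (h1 ε hε)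
  have h2 := bump_rOut_tendsto.eventually (gt_mem_nhds hδ)
  filter_upwards [h2] with n hn
  have hloc := hf.locallyIntegrable (by norm_num)
  have e : ∀ x, mollify n f x - f x = ∫ y, (f (x - y) - f x) ∂(mollMeasure n) := fun x => by
    rw [integral_sub (integrable_mollMeasure n hloc x) (integrable_const _)]
    simp [mollify]
  simp_rw [e]
  refine (lintegral_sq_integral_le volume (mollMeasure n) (F := fun z => f (z.1 - z.2) - f z.1)
    ((aestronglyMeasurable_sub_prod hf.1 (mollMeasure_absolutelyContinuous n)).sub
      hf.1.comp_fst)).trans ?_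
  refine (lintegral_mono_ae (g := fun _ => ε) ?_).trans (by simp)
  filter_upwards [mollMeasure_ae_mem n] with y hy
  exact H (by simpa using hy.trans hn)

theorem integral_fderiv_mul_weakDeriv {i : Fin 2} {f g φ : Plane → ℝ} (h : IsWeakDeriv [i] f g)
    (hφ : IsTestFunction φ) :
    ∫ x, f x * fderiv ℝ φ x (EuclideanSpace.single i 1) = -∫ x, g x * φ x := by
  simpa [classicalDeriv] using h.integral_eq φ hφ

/-- The derivative falls on the mollifier, and `z ↦ mollifier n (x - z)` is an admissible test
function; the sign from the reflection cancels the one in the weak derivative. -/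
theorem fderiv_mollify (n : ℕ) {i : Fin 2} {f g : Plane → ℝ} (h : IsWeakDeriv [i] f g)
    (x : Plane) :
    fderiv ℝ (mollify n f) x (EuclideanSpace.single i 1) = mollify n g x := by
  have h1 := (mollifier_hasCompactSupport n).hasFDerivAt_convolution_left
    (ContinuousLinearMap.lsmul ℝ ℝ) ((mollifier_contDiff n).of_le (by exact_mod_cast le_top))
    h.locallyIntegrable_left x
  rw [← mollify_eq_convolution] at h1
  have h2 := (mollifier_hasCompactSupport n).fderiv (𝕜 := ℝ) |>.convolutionExists_left
    ((ContinuousLinearMap.lsmul ℝ ℝ).precompL Plane)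
    ((mollifier_contDiff n).continuous_fderiv (by simp)) h.locallyIntegrable_left x
  have hφ : IsTestFunction (fun z => mollifier n (x - z)) :=
    ⟨(mollifier_contDiff n).comp (contDiff_const.sub contDiff_id),
      (mollifier_hasCompactSupport n).comp_homeomorph (Homeomorph.subLeft x)⟩
  have h3 := integral_fderiv_mul_weakDeriv h hφ
  have h4 : ∀ z, fderiv ℝ (fun z => mollifier n (x - z)) z (EuclideanSpace.single i 1) =
      -fderiv ℝ (mollifier n) (x - z) (EuclideanSpace.single i 1) := fun z => by
    have hd : HasFDerivAt (mollifier n) (fderiv ℝ (mollifier n) (x - z)) (x - z) :=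
      ((mollifier_contDiff n).differentiable (by simp) (x - z)).hasFDerivAt
    have hd' : HasFDerivAt (fun z => mollifier n (x - z)) _ z :=
      hd.comp z ((hasFDerivAt_id z).const_sub x)
    rw [hd'.fderiv]
    simp
  simp only [h4, mul_neg, integral_neg, neg_inj] at h3
  rw [h1.fderiv, convolution_def, ← ContinuousLinearMap.apply_apply (EuclideanSpace.single i 1),
    ← ContinuousLinearMap.integral_comp_comm _ h2, mollify_eq_integral,
    ← integral_sub_left_eq_self _ volume x]
  simp only [sub_sub_cancel]
  rw [← integral_sub_left_eq_self (fun y => mollifier n y * g (x - y)) volume x]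
  simp only [sub_sub_cancel]
  simp only [mul_comm (g _)] at h3
  rw [← h3]
  refine integral_congr_ae (ae_of_all _ fun z => ?_)
  simp [ContinuousLinearMap.precompL_apply, mul_comm]

/-! ### Sobolev estimates in the plane. -/

/-- Fatou's lemma; it carries bounds proved for mollifications over to the original functions. -/
theorem lintegral_sq_le_of_ae_tendsto {F : ℕ → Plane → ℝ} {f : Plane → ℝ} {C : ℝ≥0∞}
    (hF : ∀ n, AEStronglyMeasurable (F n)) (hlim : ∀ᵐ x, Tendsto (fun n => F n x) atTop (𝓝 (f x)))
    (hC : ∀ n, ∫⁻ x, ‖F n x‖ₑ ^ 2 ≤ C) : ∫⁻ x, ‖f x‖ₑ ^ 2 ≤ C := by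
  calc ∫⁻ x, ‖f x‖ₑ ^ 2 = ∫⁻ x, liminf (fun n => ‖F n x‖ₑ ^ 2) atTop := by
        refine lintegral_congr_ae ?_
        filter_upwards [hlim] with x hx
        exact (((ENNReal.continuous_pow 2).tendsto _).comp hx.enorm).liminf_eq.symm
    _ ≤ liminf (fun n => ∫⁻ x, ‖F n x‖ₑ ^ 2) atTop :=
        lintegral_liminf_le' fun n => (hF n).enorm.pow_const 2
    _ ≤ C := liminf_le_of_le (by isBoundedDefault) fun b hb => by
        obtain ⟨n, hn⟩ := hb.exists
        exact hn.trans (hC n)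

theorem fderiv_apply_eq (v : Plane → ℝ) (x y : Plane) :
    fderiv ℝ v x y = y 0 * fderiv ℝ v x (EuclideanSpace.single 0 1) +
      y 1 * fderiv ℝ v x (EuclideanSpace.single 1 1) := by
  have : y = y 0 • EuclideanSpace.single 0 (1 : ℝ) + y 1 • EuclideanSpace.single 1 (1 : ℝ) := by
    ext i; fin_cases i <;> simp
  conv_lhs => rw [this]
  simp

theorem enorm_fderiv_le (v : Plane → ℝ) (x : Plane) :
    ‖fderiv ℝ v x‖ₑ ≤ ‖fderiv ℝ v x (EuclideanSpace.single 0 1)‖ₑ +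
      ‖fderiv ℝ v x (EuclideanSpace.single 1 1)‖ₑ := by
  rw [← ofReal_norm, ← ofReal_norm, ← ofReal_norm,
    ← ENNReal.ofReal_add (norm_nonneg _) (norm_nonneg _)]
  refine ENNReal.ofReal_le_ofReal (ContinuousLinearMap.opNorm_le_bound _ (by positivity) fun y => ?_)
  rw [fderiv_apply_eq]
  refine (norm_add_le _ _).trans ?_
  rw [norm_mul, norm_mul, add_mul, mul_comm ‖y 0‖, mul_comm ‖y 1‖]
  gcongr <;> exact PiLp.norm_apply_le y _

/-- By the fundamental theorem of calculus the increment is the average over `t ∈ (0, 1]` of the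
derivative at `x - t • y`; each of these translates has the same `L²` norm. -/
theorem lintegral_sq_translate_sub_le_fderiv {v : Plane → ℝ} (hv : ContDiff ℝ 1 v) (y : Plane) :
    ∫⁻ x, ‖v x - v (x - y)‖ₑ ^ 2 ≤ ∫⁻ x, ‖fderiv ℝ v x y‖ₑ ^ 2 := by
  have hc : Continuous fun z => fderiv ℝ v z y :=
    (hv.continuous_fderiv (by simp)).clm_apply continuous_const
  have hP : IsProbabilityMeasure (volume.restrict (Set.Ioc (0 : ℝ) 1)) := ⟨by simp⟩
  have e : ∀ x, v x - v (x - y) = ∫ t in Set.Ioc (0 : ℝ) 1, fderiv ℝ v (x - t • y) y := fun x => by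
    rw [← intervalIntegral.integral_of_le zero_le_one]
    rw [intervalIntegral.integral_eq_sub_of_hasDerivAt (f := fun t : ℝ => -v (x - t • y))]
    · simp; ring
    · intro t _
      have h1 : HasFDerivAt v (fderiv ℝ v (x - t • y)) (x - t • y) :=
        (hv.differentiable (by simp) _).hasFDerivAt
      have h2 : HasDerivAt (fun t : ℝ => x - t • y) (-((1 : ℝ) • y)) t :=
        ((hasDerivAt_id t).smul_const y).const_sub x
      have h3 : HasDerivAt (fun t : ℝ => -v (x - t • y)) _ t := (h1.comp_hasDerivAt t h2).neg
      simpa using h3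
    · exact (hc.comp (by fun_prop)).intervalIntegrable _ _
  simp_rw [e]
  refine (lintegral_sq_integral_le volume (volume.restrict (Set.Ioc (0 : ℝ) 1))
    (F := fun z => fderiv ℝ v (z.1 - z.2 • y) y)
    (hc.comp (by fun_prop)).aestronglyMeasurable).trans ?_
  simp only [lintegral_sub_right_eq_self (fun x => ‖fderiv ℝ v x y‖ₑ ^ 2)]
  simp

theorem lintegral_sq_translate_sub_le {u : Plane → ℝ} {g : Fin 2 → Plane → ℝ}
    (hu : ∀ i, IsWeakDeriv [i] u (g i)) (y : Plane) :
    ∫⁻ x, ‖u x - u (x - y)‖ₑ ^ 2 ≤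
      ‖y‖ₑ ^ 2 * (2 * (∫⁻ x, ‖g 0 x‖ₑ ^ 2) + 2 * ∫⁻ x, ‖g 1 x‖ₑ ^ 2) := by
  have hl := (hu 0).locallyIntegrable_left
  have hsm : ∀ n, ContDiff ℝ 1 (mollify n u) := fun n =>
    (mollify_contDiff n hl).of_le (by exact_mod_cast le_top)
  refine lintegral_sq_le_of_ae_tendsto (F := fun n x => mollify n u x - mollify n u (x - y))
    (fun n => ?_) ?_ fun n => (lintegral_sq_translate_sub_le_fderiv (hsm n) y).trans ?_
  · have := (hsm n).continuous
    exact (this.sub (this.comp (by fun_prop))).aestronglyMeasurable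
  · have h1 := mollify_ae_tendsto hl
    filter_upwards [h1, (measurePreserving_sub_right volume y).quasiMeasurePreserving.ae h1]
      with x hx hx'
    exact hx.sub hx'
  · have hm : ∀ i, AEStronglyMeasurable (g i) := fun i =>
      (hu i).locallyIntegrable_right.aestronglyMeasurable
    have hy : ∀ i, ‖y i‖ₑ ≤ ‖y‖ₑ := fun i => by
      rw [← ofReal_norm, ← ofReal_norm]
      exact ENNReal.ofReal_le_ofReal (PiLp.norm_apply_le y i)
    have hb : ∀ i, ∫⁻ x, ‖y i * mollify n (g i) x‖ₑ ^ 2 ≤ ‖y‖ₑ ^ 2 * ∫⁻ x, ‖g i x‖ₑ ^ 2 :=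
      fun i => by
      simp_rw [enorm_mul, mul_pow]
      rw [lintegral_const_mul'' _ ((aestronglyMeasurable_mollify n (hm i)).enorm.pow_const 2)]
      exact mul_le_mul' (pow_le_pow_left' (hy i) 2) (lintegral_sq_mollify_le n (hm i))
    have hmm : ∀ i, AEMeasurable (fun x => ‖y i * mollify n (g i) x‖ₑ ^ 2) := fun i =>
      ((aestronglyMeasurable_mollify n (hm i)).const_mul (y i)).enorm.pow_const 2
    calc _ ≤ ∫⁻ x, (2 * ‖y 0 * mollify n (g 0) x‖ₑ ^ 2 + 2 * ‖y 1 * mollify n (g 1) x‖ₑ ^ 2) := by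
          refine lintegral_mono fun x => ?_
          rw [fderiv_apply_eq, fderiv_mollify n (hu 0), fderiv_mollify n (hu 1)]
          exact enorm_add_sq_le _ _
      _ = 2 * (∫⁻ x, ‖y 0 * mollify n (g 0) x‖ₑ ^ 2) + 2 * ∫⁻ x, ‖y 1 * mollify n (g 1) x‖ₑ ^ 2 := by
          rw [lintegral_add_left' ((hmm 0).const_mul _), lintegral_const_mul'' _ (hmm 0),
            lintegral_const_mul'' _ (hmm 1)]
      _ ≤ 2 * (‖y‖ₑ ^ 2 * ∫⁻ x, ‖g 0 x‖ₑ ^ 2) + 2 * (‖y‖ₑ ^ 2 * ∫⁻ x, ‖g 1 x‖ₑ ^ 2) := by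
          exact add_le_add (mul_le_mul_right (hb 0) 2) (mul_le_mul_right (hb 1) 2)
      _ = _ := by ring

theorem ENNReal.mul_le_sq_add_sq (a b : ℝ≥0∞) : a * b ≤ a ^ 2 + b ^ 2 := by
  rcases le_total a b with h | h
  · exact (mul_le_mul_left h b).trans (by rw [sq b]; exact le_add_self)
  · exact (mul_le_mul_right h a).trans (by rw [sq a]; exact le_self_add)

/-- The gradient of `u v` is bounded in `L¹` by Cauchy–Schwarz, and the Gagliardo–Nirenberg–Sobolev
inequality turns this into an `L²` bound. It is applied to the product of mollifications, uniformly
in `n`. -/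
theorem memLp_mul_of_isWeakDeriv {u v : Plane → ℝ} {u' v' : Fin 2 → Plane → ℝ}
    (hu : ∀ i, IsWeakDeriv [i] u (u' i)) (hv : ∀ i, IsWeakDeriv [i] v (v' i))
    (hu2 : MemLp u 2) (hv2 : MemLp v 2) (hu2' : ∀ i, MemLp (u' i) 2) (hv2' : ∀ i, MemLp (v' i) 2)
    (hus : HasCompactSupport u) : MemLp (fun x => u x * v x) 2 := by
  have hul := (hu 0).locallyIntegrable_left
  have hvl := (hv 0).locallyIntegrable_left
  set N : (Plane → ℝ) → ℝ≥0∞ := fun f => ∫⁻ x, ‖f x‖ₑ ^ 2 with hN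
  have hfin : ∀ {f}, MemLp f 2 → N f < ⊤ := fun hf => (memLp_two_iff.1 hf).2
  set A : Fin 2 → ℝ≥0∞ := fun i => (N u + N (v' i)) + (N (u' i) + N v) with hA
  set C := eLpNormLESNormFDerivOneConst (volume : Measure Plane) ((2 : NNReal) : ℝ) with hC
  have hsm : ∀ n {f : Plane → ℝ}, LocallyIntegrable f → ContDiff ℝ 1 (mollify n f) := fun n _ h =>
    (mollify_contDiff n h).of_le (by exact_mod_cast le_top)
  have key : ∀ n, ∫⁻ x, ‖mollify n u x * mollify n v x‖ₑ ^ 2 ≤ (C * (A 0 + A 1)) ^ 2 := fun n => by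
    rw [← eLpNorm_two_sq]
    gcongr
    -- In dimension two the Sobolev exponent of `1` is `2`.
    have hp : NNReal.HolderConjugate (Module.finrank ℝ Plane : ℕ) 2 := by
      rw [finrank_euclideanSpace_fin]
      exact_mod_cast NNReal.HolderConjugate.two_two
    have h1 := eLpNorm_le_eLpNorm_fderiv_one (volume : Measure Plane)
      (u := fun x => mollify n u x * mollify n v x) ((hsm n hul).mul (hsm n hvl))
      (mollify_hasCompactSupport n hus).mul_right (p := 2) hp
    refine h1.trans ?_
    gcongr
    rw [eLpNorm_one_eq_lintegral_enorm]
    have hd : ∀ x i, fderiv ℝ (fun x => mollify n u x * mollify n v x) x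
        (EuclideanSpace.single i 1) =
        mollify n u x * mollify n (v' i) x + mollify n (u' i) x * mollify n v x := fun x i => by
      rw [fderiv_fun_mul ((hsm n hul).differentiable (by simp) x)
        ((hsm n hvl).differentiable (by simp) x)]
      simp [fderiv_mollify n (hu i), fderiv_mollify n (hv i), mul_comm]
    have hmul : ∀ {f g : Plane → ℝ}, MemLp f 2 → MemLp g 2 →
        ∫⁻ x, ‖mollify n f x * mollify n g x‖ₑ ≤ N f + N g := fun {f g} hf hg => by
      calc _ ≤ ∫⁻ x, (‖mollify n f x‖ₑ ^ 2 + ‖mollify n g x‖ₑ ^ 2) :=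
            lintegral_mono fun x => by
              rw [enorm_mul]; exact ENNReal.mul_le_sq_add_sq _ _
        _ = (∫⁻ x, ‖mollify n f x‖ₑ ^ 2) + ∫⁻ x, ‖mollify n g x‖ₑ ^ 2 :=
            lintegral_add_left' ((aestronglyMeasurable_mollify n hf.1).enorm.pow_const 2) _
        _ ≤ _ := add_le_add (lintegral_sq_mollify_le n hf.1) (lintegral_sq_mollify_le n hg.1)
    have hm : ∀ {f g : Plane → ℝ}, MemLp f 2 → MemLp g 2 →
        AEMeasurable fun x => ‖mollify n f x * mollify n g x‖ₑ := fun hf hg =>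
      ((aestronglyMeasurable_mollify n hf.1).mul (aestronglyMeasurable_mollify n hg.1)).enorm
    have hi : ∀ i, ∫⁻ x, (‖mollify n u x * mollify n (v' i) x‖ₑ +
        ‖mollify n (u' i) x * mollify n v x‖ₑ) ≤ A i := fun i => by
      rw [lintegral_add_left' (hm hu2 (hv2' i))]
      exact add_le_add (hmul hu2 (hv2' i)) (hmul (hu2' i) hv2)
    calc _ ≤ ∫⁻ x, ((‖mollify n u x * mollify n (v' 0) x‖ₑ +
            ‖mollify n (u' 0) x * mollify n v x‖ₑ) + (‖mollify n u x * mollify n (v' 1) x‖ₑ +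
            ‖mollify n (u' 1) x * mollify n v x‖ₑ)) := lintegral_mono fun x => by
          refine (enorm_fderiv_le _ x).trans ?_
          rw [hd, hd]
          exact add_le_add (enorm_add_le _ _) (enorm_add_le _ _)
      _ ≤ A 0 + A 1 := by
          have hm0 : AEMeasurable fun x => ‖mollify n u x * mollify n (v' 0) x‖ₑ +
            ‖mollify n (u' 0) x * mollify n v x‖ₑ := (hm hu2 (hv2' 0)).add (hm (hu2' 0) hv2)
          rw [lintegral_add_left' hm0]
          exact add_le_add (hi 0) (hi 1)
  refine memLp_two_iff.2 ⟨hu2.1.mul hv2.1, lt_of_le_of_lt (lintegral_sq_le_of_ae_tendsto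
    (F := fun n x => mollify n u x * mollify n v x) (fun n => ?_) ?_ key) ?_⟩
  · exact (aestronglyMeasurable_mollify n hu2.1).mul (aestronglyMeasurable_mollify n hv2.1)
  · filter_upwards [mollify_ae_tendsto hul, mollify_ae_tendsto hvl] with x hx hx'
    exact hx.mul hx'
  · have : ∀ i, A i < ⊤ := fun i => by
      simp only [hA, ENNReal.add_lt_top]
      exact ⟨⟨hfin hu2, hfin (hv2' i)⟩, hfin (hu2' i), hfin hv2⟩
    exact ENNReal.pow_lt_top (ENNReal.mul_lt_top ENNReal.coe_lt_top
      (ENNReal.add_lt_top.2 ⟨this 0, this 1⟩))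

/-! ### The commutator of mollification and multiplication. -/

/-- The area of a disc scales as the radius squared; the `4` is the square of the ratio of the two
radii of the bump. -/
theorem sq_rOut_mul_mollifier_le (n : ℕ) (y : Plane) :
    (bump n).rOut ^ 2 * mollifier n y ≤ 4 / volume.real (Metric.closedBall (0 : Plane) 1) := by
  have h := (bump n).normed_le_div_measure_closedBall_rOut volume 2 (bump_rOut_eq n).le y
  rw [Measure.addHaar_real_closedBall' _ _ (bump n).rOut_pos.le, finrank_euclideanSpace_fin] at h
  have hr := (bump n).rOut_pos
  calc _ ≤ (bump n).rOut ^ 2 * (2 ^ 2 /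
        ((bump n).rOut ^ 2 * volume.real (Metric.closedBall (0 : Plane) 1))) :=
        mul_le_mul_of_nonneg_left h (by positivity)
    _ = _ := by field_simp; norm_num

theorem sq_mul_lintegral_mollMeasure_le (n : ℕ) {F : Plane → ℝ≥0∞} (x : Plane) :
    ENNReal.ofReal ((bump n).rOut ^ 2) * ∫⁻ y, F (x - y) ∂(mollMeasure n) ≤
      ENNReal.ofReal (4 / volume.real (Metric.closedBall (0 : Plane) 1)) *
        ∫⁻ z in Metric.closedBall x (bump n).rOut, F z := by
  set r := ENNReal.ofReal ((bump n).rOut ^ 2) with hr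
  set K := ENNReal.ofReal (4 / volume.real (Metric.closedBall (0 : Plane) 1)) with hK
  calc _ ≤ r * ∫⁻ y, ENNReal.ofReal (mollifier n y) * F (x - y) :=
        mul_le_mul_right (lintegral_withDensity_le_lintegral_mul volume
          (measurable_mollifier n).ennreal_ofReal _) r
    _ = ∫⁻ y, r * (ENNReal.ofReal (mollifier n y) * F (x - y)) :=
        (lintegral_const_mul' _ _ ENNReal.ofReal_ne_top).symm
    _ = ∫⁻ z, r * (ENNReal.ofReal (mollifier n (x - z)) * F z) := by
        rw [← lintegral_sub_left_eq_self _ x]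
        simp
    _ ≤ ∫⁻ z, (Metric.closedBall x (bump n).rOut).indicator (fun z => K * F z) z := by
        refine lintegral_mono fun z => ?_
        by_cases hz : z ∈ Metric.closedBall x (bump n).rOut
        · rw [Set.indicator_of_mem hz, ← mul_assoc]
          refine mul_le_mul_left ?_ _
          rw [hr, ← ENNReal.ofReal_mul (sq_nonneg _)]
          exact ENNReal.ofReal_le_ofReal (sq_rOut_mul_mollifier_le n _)
        · have h0 : mollifier n (x - z) = 0 := by
            have : x - z ∉ Function.support (mollifier n) := by
              rw [mollifier, (bump n).support_normed_eq]
              intro h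
              apply hz
              rw [Metric.mem_closedBall, dist_comm, dist_eq_norm]
              exact (mem_ball_zero_iff.1 h).le
            simpa using this
          simp [h0]
    _ = K * ∫⁻ z in Metric.closedBall x (bump n).rOut, F z := by
        rw [lintegral_indicator Metric.isClosed_closedBall.measurableSet,
          lintegral_const_mul' _ _ ENNReal.ofReal_ne_top]

/-- Absolute continuity of the integral; the supremum is harmless because the area of a disc does
not depend on its centre. -/
theorem tendsto_iSup_setLIntegral_closedBall {F : Plane → ℝ≥0∞} (hF : ∫⁻ x, F x ≠ ⊤) :
    Tendsto (fun n => ⨆ x, ∫⁻ z in Metric.closedBall x (bump n).rOut, F z) atTop (𝓝 0) := by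
  rw [ENNReal.tendsto_nhds_zero]
  intro ε hε
  obtain ⟨δ, hδ, H⟩ := exists_pos_setLIntegral_lt_of_measure_lt hF hε.ne'
  have h1 : Tendsto (fun n => volume (Metric.closedBall (0 : Plane) (bump n).rOut)) atTop
      (𝓝 0) := by
    have h2 : Tendsto (fun n => ENNReal.ofReal ((bump n).rOut ^ 2) *
        volume (Metric.closedBall (0 : Plane) 1)) atTop (𝓝 0) := by
      have := ENNReal.Tendsto.mul_const (b := volume (Metric.closedBall (0 : Plane) 1))
        (ENNReal.tendsto_ofReal (bump_rOut_tendsto.pow 2))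
        (Or.inr (measure_closedBall_lt_top.ne))
      simpa using this
    refine h2.congr fun n => ?_
    rw [Measure.addHaar_closedBall' _ _ (bump n).rOut_pos.le, finrank_euclideanSpace_fin]
  filter_upwards [h1.eventually (gt_mem_nhds hδ)] with n hn
  refine iSup_le fun x => (H _ ?_).le
  rwa [Measure.addHaar_closedBall_center]

/-- The commutator at `x` is the average of `(b x - b (x - y)) g (x - y)`. By Cauchy–Schwarz its
square is at most the average of `|b x - b (x - y)|²` times that of `|g (x - y)|²`. With `r` the
squared radius, the first factor integrates to at most `r * M`, and the second is at most `r⁻¹ * K`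
times the largest mass of `|g|²` on a disc of that radius. The powers of the radius cancel exactly
in dimension two, and the local mass of `|g|²` tends to zero. -/
theorem tendsto_commutator {b g : Plane → ℝ} {b' : Fin 2 → Plane → ℝ}
    (hb : ∀ i, IsWeakDeriv [i] b (b' i)) (hb' : ∀ i, MemLp (b' i) 2) (hg : MemLp g 2)
    (hbg : LocallyIntegrable fun x => b x * g x) :
    Tendsto (fun n => eLpNorm (fun x => b x * mollify n g x - mollify n (fun x => b x * g x) x)
      2 volume) atTop (𝓝 0) := by
  rw [tendsto_eLpNorm_two_zero_iff]
  have hgl := hg.locallyIntegrable (by norm_num)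
  have hbm := (hb 0).locallyIntegrable_left.aestronglyMeasurable
  set M : ℝ≥0∞ := 2 * (∫⁻ x, ‖b' 0 x‖ₑ ^ 2) + 2 * ∫⁻ x, ‖b' 1 x‖ₑ ^ 2 with hM
  set K := ENNReal.ofReal (4 / volume.real (Metric.closedBall (0 : Plane) 1)) with hK
  have hMfin : M ≠ ⊤ := by
    have : ∀ i, ∫⁻ x, ‖b' i x‖ₑ ^ 2 < ⊤ := fun i => (memLp_two_iff.1 (hb' i)).2
    exact (ENNReal.add_lt_top.2 ⟨ENNReal.mul_lt_top (by norm_num) (this 0),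
      ENNReal.mul_lt_top (by norm_num) (this 1)⟩).ne
  have hlim : Tendsto (fun n => M * (K * ⨆ x, ∫⁻ z in Metric.closedBall x (bump n).rOut,
      ‖g z‖ₑ ^ 2)) atTop (𝓝 0) := by
    have := ENNReal.Tendsto.const_mul (a := M) (ENNReal.Tendsto.const_mul (a := K)
      (tendsto_iSup_setLIntegral_closedBall (memLp_two_iff.1 hg).2.ne)
      (Or.inr ENNReal.ofReal_ne_top)) (Or.inr hMfin)
    simpa using this
  refine tendsto_of_tendsto_of_tendsto_of_le_of_le tendsto_const_nhds hlim (fun _ => zero_le)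
    fun n => ?_
  have hac := mollMeasure_absolutelyContinuous n
  have hD : AEStronglyMeasurable (fun z : Plane × Plane => b z.1 - b (z.1 - z.2))
      (volume.prod (mollMeasure n)) := hbm.comp_fst.sub (aestronglyMeasurable_sub_prod hbm hac)
  have hpt : ∀ x, ‖b x * mollify n g x - mollify n (fun x => b x * g x) x‖ₑ ^ 2 ≤
      (∫⁻ y, ‖b x - b (x - y)‖ₑ ^ 2 ∂(mollMeasure n)) * ∫⁻ y, ‖g (x - y)‖ₑ ^ 2 ∂(mollMeasure n) :=
    fun x => by
    have e : b x * mollify n g x - mollify n (fun x => b x * g x) x =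
        ∫ y, (b x - b (x - y)) * g (x - y) ∂(mollMeasure n) := by
      simp_rw [sub_mul]
      rw [integral_sub ((integrable_mollMeasure n hgl x).const_mul _)
        (integrable_mollMeasure n hbg x), integral_const_mul]
      rfl
    rw [e]
    refine (pow_le_pow_left' (enorm_integral_le_lintegral_enorm _) 2).trans ?_
    simp_rw [enorm_mul]
    exact sq_lintegral_mul_le _
      (aestronglyMeasurable_const.sub (aestronglyMeasurable_sub_left hbm hac x)).enorm
      (aestronglyMeasurable_sub_left hg.1 hac x).enorm
  set r := ENNReal.ofReal ((bump n).rOut ^ 2) with hr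
  have hrpos : 0 < (bump n).rOut ^ 2 := pow_pos (bump n).rOut_pos 2
  have hr0 : r ≠ 0 := by simpa [hr] using hrpos.ne'
  have hrtop : r ≠ ⊤ := ENNReal.ofReal_ne_top
  set S := ⨆ x, ∫⁻ z in Metric.closedBall x (bump n).rOut, ‖g z‖ₑ ^ 2 with hS
  have hgS : ∀ x, ∫⁻ y, ‖g (x - y)‖ₑ ^ 2 ∂(mollMeasure n) ≤ r⁻¹ * (K * S) := fun x => by
    rw [mul_comm, ← div_eq_mul_inv, ENNReal.le_div_iff_mul_le (Or.inl hr0) (Or.inl hrtop), mul_comm]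
    refine (sq_mul_lintegral_mollMeasure_le n (F := fun z => ‖g z‖ₑ ^ 2) x).trans ?_
    exact mul_le_mul_right (le_iSup (fun x => ∫⁻ z in Metric.closedBall x (bump n).rOut,
      ‖g z‖ₑ ^ 2) x) K
  have hbS : ∫⁻ x, ∫⁻ y, ‖b x - b (x - y)‖ₑ ^ 2 ∂(mollMeasure n) ≤ r * M := by
    rw [lintegral_lintegral_swap (hD.enorm.pow_const 2)]
    refine (lintegral_mono_ae (g := fun _ => r * M) ?_).trans (by simp)
    filter_upwards [mollMeasure_ae_mem n] with y hy
    refine (lintegral_sq_translate_sub_le hb y).trans (mul_le_mul_left ?_ M)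
    rw [← ofReal_norm, ← ENNReal.ofReal_pow (norm_nonneg y), hr, bump_rOut]
    exact ENNReal.ofReal_le_ofReal (pow_le_pow_left₀ (norm_nonneg y) hy.le 2)
  calc _ ≤ ∫⁻ x, (∫⁻ y, ‖b x - b (x - y)‖ₑ ^ 2 ∂(mollMeasure n)) * (r⁻¹ * (K * S)) :=
        lintegral_mono fun x => (hpt x).trans (mul_le_mul_right (hgS x) _)
    _ = (∫⁻ x, ∫⁻ y, ‖b x - b (x - y)‖ₑ ^ 2 ∂(mollMeasure n)) * (r⁻¹ * (K * S)) :=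
        lintegral_mul_const'' _ (hD.enorm.pow_const 2).lintegral_prod_right'
    _ ≤ r * M * (r⁻¹ * (K * S)) := mul_le_mul_left hbS _
    _ = (r * r⁻¹) * (M * (K * S)) := by ring
    _ = M * (K * S) := by rw [ENNReal.mul_inv_cancel hr0 hrtop, one_mul]

/-! ### Calculus of weak derivatives and localisation. -/

theorem HallMHD.IsWeakDeriv.ae_eq {α : List (Fin 2)} {f g k : Plane → ℝ} (hg : IsWeakDeriv α f g)
    (hk : IsWeakDeriv α f k) : g =ᵐ[volume] k := by
  refine ae_eq_of_integral_contDiff_smul_eq hg.locallyIntegrable_right hk.locallyIntegrable_right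
    fun φ h1 h2 => ?_
  have := (hg.integral_eq φ ⟨h1, h2⟩).symm.trans (hk.integral_eq φ ⟨h1, h2⟩)
  simpa [mul_comm] using this

theorem isWeakDeriv_weakDeriv {α : List (Fin 2)} {f : Plane → ℝ} (h : ∃ g, IsWeakDeriv α f g) :
    IsWeakDeriv α f (weakDeriv α f) := by
  rw [weakDeriv, dif_pos h]
  exact h.choose_spec

theorem HallMHD.IsWeakDeriv.weakDeriv_ae_eq {α : List (Fin 2)} {f g : Plane → ℝ} (h : IsWeakDeriv α f g) :
    weakDeriv α f =ᵐ[volume] g :=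
  (isWeakDeriv_weakDeriv ⟨g, h⟩).ae_eq h

theorem HallMHD.IsTestFunction.fderiv_apply {φ : Plane → ℝ} (h : IsTestFunction φ) (v : Plane) :
    IsTestFunction fun x => fderiv ℝ φ x v :=
  ⟨(h.1.fderiv_right (m := ∞) (by simp)).clm_apply contDiff_const,
    h.2.fderiv_apply (𝕜 := ℝ) v⟩

theorem HallMHD.IsTestFunction.integral_fderiv_eq_zero {φ : Plane → ℝ} (h : IsTestFunction φ) (v : Plane) :
    ∫ x, fderiv ℝ φ x v = 0 := by
  have hi : ∀ {ψ : Plane → ℝ}, IsTestFunction ψ → Integrable ψ := fun h =>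
    h.1.continuous.integrable_of_hasCompactSupport h.2
  have := integral_mul_fderiv_eq_neg_fderiv_mul_of_integrable (μ := (volume : Measure Plane))
    (𝕜 := ℝ) (f := fun _ => (1 : ℝ)) (g := φ) (v := v) (by simp)
    (by simpa using hi (h.fderiv_apply v)) (by simpa using hi h) (fun _ _ => by fun_prop)
    (fun x _ => h.1.differentiable (by simp) x)
  simpa using this

theorem MeasureTheory.LocallyIntegrable.mul_testFunction {f φ : Plane → ℝ}
    (hf : LocallyIntegrable f) (hφ : IsTestFunction φ) : Integrable fun x => f x * φ x := by
  simpa [mul_comm] using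
    hf.integrable_smul_left_of_hasCompactSupport hφ.1.continuous hφ.2

theorem HallMHD.IsWeakDeriv.sub_const {i : Fin 2} {f g : Plane → ℝ} (h : IsWeakDeriv [i] f g) (c : ℝ) :
    IsWeakDeriv [i] (fun x => f x - c) g where
  locallyIntegrable_left := h.locallyIntegrable_left.sub (locallyIntegrable_const c)
  locallyIntegrable_right := h.locallyIntegrable_right
  integral_eq φ hφ := by
    rw [← h.integral_eq φ hφ]
    have hd := hφ.fderiv_apply (EuclideanSpace.single i 1)
    simp_rw [classicalDeriv, sub_mul]
    rw [integral_sub (h.locallyIntegrable_left.mul_testFunction hd)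
      ((locallyIntegrable_const c).mul_testFunction hd), integral_const_mul,
      hφ.integral_fderiv_eq_zero]
    simp

theorem HallMHD.IsWeakDeriv.mul_testFunction {i : Fin 2} {f g ζ : Plane → ℝ} (h : IsWeakDeriv [i] f g)
    (hζ : IsTestFunction ζ) :
    IsWeakDeriv [i] (fun x => f x * ζ x)
      (fun x => g x * ζ x + f x * fderiv ℝ ζ x (EuclideanSpace.single i 1)) where
  locallyIntegrable_left := (h.locallyIntegrable_left.mul_testFunction hζ).locallyIntegrable
  locallyIntegrable_right := ((h.locallyIntegrable_right.mul_testFunction hζ).add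
    (h.locallyIntegrable_left.mul_testFunction (hζ.fderiv_apply _))).locallyIntegrable
  integral_eq φ hφ := by
    have hmul : ∀ {φ ψ : Plane → ℝ}, IsTestFunction φ → IsTestFunction ψ →
        IsTestFunction fun x => φ x * ψ x := fun h k => ⟨h.1.mul k.1, h.2.mul_right⟩
    have h1 := integral_fderiv_mul_weakDeriv h (hmul hζ hφ)
    set e : Plane := EuclideanSpace.single i 1
    have hd : ∀ x, fderiv ℝ (fun x => ζ x * φ x) x e =
        ζ x * fderiv ℝ φ x e + fderiv ℝ ζ x e * φ x := fun x => by
      rw [fderiv_fun_mul (hζ.1.differentiable (by simp) x) (hφ.1.differentiable (by simp) x)]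
      simp [mul_comm]
    simp only [hd, mul_add] at h1
    rw [integral_add (h.locallyIntegrable_left.mul_testFunction (hmul hζ (hφ.fderiv_apply e)))
      (h.locallyIntegrable_left.mul_testFunction (hmul (hζ.fderiv_apply e) hφ))] at h1
    simp only [classicalDeriv, List.length_singleton, pow_one, add_mul, mul_assoc, neg_one_mul]
    rw [integral_add (h.locallyIntegrable_right.mul_testFunction (hmul hζ hφ))
      (h.locallyIntegrable_left.mul_testFunction (hmul (hζ.fderiv_apply e) hφ))]
    linarith

/-- In `classicalDeriv [j, i]` the direction `i` acts first, so the claim follows by testing `h`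
with `∂_i φ`. -/
theorem HallMHD.IsWeakDeriv.fderiv_step {i j : Fin 2} {f g k : Plane → ℝ} (h : IsWeakDeriv [j] f g)
    (h2 : IsWeakDeriv [j, i] f k) : IsWeakDeriv [i] g k where
  locallyIntegrable_left := h.locallyIntegrable_right
  locallyIntegrable_right := h2.locallyIntegrable_right
  integral_eq φ hφ := by
    have e1 := h.integral_eq _ (hφ.fderiv_apply (EuclideanSpace.single i 1))
    have e2 := h2.integral_eq φ hφ
    simp only [classicalDeriv, List.length_cons, List.length_nil] at e1 e2 ⊢
    rw [e2] at e1
    norm_num at e1 ⊢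
    linarith

theorem memLp_mul_testFunction {f φ : Plane → ℝ} (hf : MemLpLoc 2 f) (hφ : IsTestFunction φ) :
    MemLp (fun x => f x * φ x) 2 := by
  have hK := hf _ hφ.2.isCompact
  have hφ' : MemLp φ ⊤ (volume.restrict (tsupport φ)) :=
    (hφ.1.continuous.memLp_of_hasCompactSupport hφ.2).restrict _
  have h : MemLp (fun x => f x * φ x) 2 (volume.restrict (tsupport φ)) := hφ'.mul hK
  have e : (fun x => f x * φ x) = (tsupport φ).indicator fun x => f x * φ x := by
    funext x
    by_cases hx : x ∈ tsupport φ
    · simp [hx]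
    · simp [hx, image_eq_zero_of_notMem_tsupport hx]
  rw [e]
  exact (memLp_indicator_iff_restrict (isClosed_tsupport φ).measurableSet).2 h

theorem MeasureTheory.MemLp.integrable_fun_mul {X : Type*} [MeasurableSpace X] {μ : Measure X}
    {f g : X → ℝ} (hf : MemLp f 2 μ) (hg : MemLp g 2 μ) : Integrable (fun x => f x * g x) μ :=
  MemLp.integrable_mul hf hg

theorem MeasureTheory.MemLp.memLpLoc {f : Plane → ℝ} {s : ℝ≥0∞} (hf : MemLp f s) : MemLpLoc s f :=
  fun _ _ => hf.restrict _

theorem exists_testFunction_eq_one {K : Set Plane} (hK : IsCompact K) :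
    ∃ η, IsTestFunction η ∧ ∀ x ∈ K, η x = 1 := by
  obtain ⟨R, hR, hKR⟩ := hK.isBounded.subset_closedBall_lt 0 0
  let B : ContDiffBump (0 : Plane) := ⟨R, R + 1, hR, by linarith⟩
  exact ⟨B, ⟨B.contDiff, B.hasCompactSupport⟩, fun x hx => B.one_of_mem_closedBall (hKR hx)⟩

/-- A second cutoff `η`, equal to `1` on the support of `χ`, makes both factors global `W^{1,2}`
functions without changing the product. -/
theorem memLp_mul_mul_testFunction {u v χ : Plane → ℝ} {u' v' : Fin 2 → Plane → ℝ}
    (hu : ∀ i, IsWeakDeriv [i] u (u' i)) (hv : ∀ i, IsWeakDeriv [i] v (v' i))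
    (hu2 : MemLpLoc 2 u) (hv2 : MemLpLoc 2 v) (hu2' : ∀ i, MemLpLoc 2 (u' i))
    (hv2' : ∀ i, MemLpLoc 2 (v' i)) (hχ : IsTestFunction χ) :
    MemLp (fun x => u x * χ x * v x) 2 := by
  obtain ⟨η, hη, h1⟩ := exists_testFunction_eq_one hχ.2.isCompact
  have h := memLp_mul_of_isWeakDeriv (fun i => (hu i).mul_testFunction hχ)
    (fun i => (hv i).mul_testFunction hη) (memLp_mul_testFunction hu2 hχ)
    (memLp_mul_testFunction hv2 hη)
    (fun i => (memLp_mul_testFunction (hu2' i) hχ).add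
      (memLp_mul_testFunction hu2 (hχ.fderiv_apply _)))
    (fun i => (memLp_mul_testFunction (hv2' i) hη).add
      (memLp_mul_testFunction hv2 (hη.fderiv_apply _))) hχ.2.mul_left
  have e : (fun x => u x * χ x * v x) = fun x => u x * χ x * (v x * η x) := by
    funext x
    by_cases hx : x ∈ tsupport χ
    · rw [h1 x hx, mul_one]
    · simp [image_eq_zero_of_notMem_tsupport hx]
  rw [e]
  exact h

/-! ### Passage to the limit in the second equation. -/

theorem tendsto_integral_mul_of_tendsto_eLpNorm {a F : Plane → ℝ} {G : ℕ → Plane → ℝ}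
    (ha : MemLp a 2) (hF : MemLp F 2) (hG : ∀ n, MemLp (G n) 2)
    (h : Tendsto (fun n => eLpNorm (fun x => G n x - F x) 2 volume) atTop (𝓝 0)) :
    Tendsto (fun n => ∫ x, a x * G n x) atTop (𝓝 (∫ x, a x * F x)) := by
  refine tendsto_integral_of_L1' (fun x => a x * F x) (ha.integrable_fun_mul hF).1
    (Eventually.of_forall fun n => ha.integrable_fun_mul (hG n)) ?_
  have hlim : Tendsto (fun n => eLpNorm a 2 volume * eLpNorm (fun x => G n x - F x) 2 volume)
      atTop (𝓝 0) := by
    simpa using ENNReal.Tendsto.const_mul h (Or.inr ha.2.ne)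
  refine tendsto_of_tendsto_of_tendsto_of_le_of_le tendsto_const_nhds hlim (fun _ => zero_le)
    fun n => ?_
  have := eLpNorm_smul_le_mul_eLpNorm (p := 2) (q := 2) (r := 1) (μ := (volume : Measure Plane))
    ((hG n).1.sub hF.1) ha.1
  refine le_trans (le_of_eq ?_) this
  congr 1
  funext x
  simp [mul_sub]

theorem tendsto_eLpNorm_mollify_sub {f : Plane → ℝ} (hf : MemLp f 2) :
    Tendsto (fun n => eLpNorm (fun x => mollify n f x - f x) 2 volume) atTop (𝓝 0) :=
  tendsto_eLpNorm_two_zero_iff.2 (tendsto_lintegral_sq_mollify_sub hf)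

theorem MemLpLoc.locallyIntegrable_mul {b g : Plane → ℝ} (hb : MemLpLoc 2 b) (hg : MemLp g 2) :
    LocallyIntegrable fun x => b x * g x := by
  rw [locallyIntegrable_iff]
  intro K hK
  exact (hb K hK).integrable_fun_mul (hg.restrict K)

/-- The mollified product `b₁ ∂₀φ - b₀ ∂₁φ` converges in `L²`, if its limit is in `L²`. -/
theorem tendsto_eLpNorm_cross_mollify_sub {b g : Fin 2 → Plane → ℝ} {b' : Fin 2 → Fin 2 → Plane → ℝ}
    (hb : ∀ j i, IsWeakDeriv [i] (b j) (b' j i)) (hb2 : ∀ j, MemLpLoc 2 (b j))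
    (hb' : ∀ j i, MemLp (b' j i) 2) (hg : ∀ i, MemLp (g i) 2)
    (hG : MemLp (fun x => b 1 x * g 0 x - b 0 x * g 1 x) 2) :
    Tendsto (fun n => eLpNorm (fun x => (b 1 x * mollify n (g 0) x - b 0 x * mollify n (g 1) x) -
      (b 1 x * g 0 x - b 0 x * g 1 x)) 2 volume) atTop (𝓝 0) := by
  have hbg : ∀ j i, LocallyIntegrable fun x => b j x * g i x := fun j i =>
    MemLpLoc.locallyIntegrable_mul (hb2 j) (hg i)
  have hc : ∀ j i, Tendsto (fun n => eLpNorm (fun x => b j x * mollify n (g i) x -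
      mollify n (fun x => b j x * g i x) x) 2 volume) atTop (𝓝 0) := fun j i =>
    tendsto_commutator (hb j) (hb' j) (hg i) (hbg j i)
  have hcm : ∀ j i n, AEStronglyMeasurable (fun x => b j x * mollify n (g i) x -
      mollify n (fun x => b j x * g i x) x) := fun j i n =>
    ((hb j 0).locallyIntegrable_left.aestronglyMeasurable.mul
      (aestronglyMeasurable_mollify n (hg i).1)).sub
      (aestronglyMeasurable_mollify n (hbg j i).aestronglyMeasurable)
  have hlim := ((hc 1 0).add (hc 0 1)).add (tendsto_eLpNorm_mollify_sub hG)
  rw [add_zero, add_zero] at hlim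
  refine tendsto_of_tendsto_of_tendsto_of_le_of_le tendsto_const_nhds hlim (fun _ => zero_le)
    fun n => ?_
  -- The error is a difference of two commutators plus the mollification error of the whole cross
  -- term; only the latter needs square integrability of the limit.
  have e : (fun x => (b 1 x * mollify n (g 0) x - b 0 x * mollify n (g 1) x) -
      (b 1 x * g 0 x - b 0 x * g 1 x)) =
      ((fun x => b 1 x * mollify n (g 0) x - mollify n (fun x => b 1 x * g 0 x) x) -
        (fun x => b 0 x * mollify n (g 1) x - mollify n (fun x => b 0 x * g 1 x) x)) +
      fun x => mollify n (fun x => b 1 x * g 0 x - b 0 x * g 1 x) x -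
        (b 1 x * g 0 x - b 0 x * g 1 x) := by
    funext x
    have : mollify n (fun x => b 1 x * g 0 x - b 0 x * g 1 x) x =
        mollify n (fun x => b 1 x * g 0 x) x - mollify n (fun x => b 0 x * g 1 x) x :=
      integral_sub (integrable_mollMeasure n (hbg 1 0) x) (integrable_mollMeasure n (hbg 0 1) x)
    simp only [Pi.add_apply, Pi.sub_apply, this]
    ring
  rw [e]
  refine (eLpNorm_add_le ((hcm 1 0 n).sub (hcm 0 1 n))
    ((aestronglyMeasurable_mollify n hG.1).sub hG.1) (by norm_num)).trans ?_
  exact add_le_add_left (eLpNorm_sub_le (hcm 1 0 n) (hcm 0 1 n) (by norm_num)) _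

theorem gradient_apply_eq (φ : Plane → ℝ) (x : Plane) (i : Fin 2) :
    (∇ φ x) i = fderiv ℝ φ x (EuclideanSpace.single i 1) := by
  have := InnerProductSpace.toDual_symm_apply (𝕜 := ℝ) (x := EuclideanSpace.single i (1 : ℝ))
    (y := fderiv ℝ φ x)
  rw [← this, EuclideanSpace.inner_single_right]
  simp [gradient]

theorem inner_plane (v w : Plane) : ⟪v, w⟫ = v 0 * w 0 + v 1 * w 1 := by
  simp [PiLp.inner_apply, Fin.sum_univ_two, mul_comm]

theorem weakGrad_zero (f : Plane → ℝ) (x : Plane) : weakGrad f x 0 = weakDeriv [0] f x := rfl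
theorem weakGrad_one (f : Plane → ℝ) (x : Plane) : weakGrad f x 1 = weakDeriv [1] f x := rfl
theorem perp_zero (v : Plane) : perp v 0 = -v 1 := rfl
theorem perp_one (v : Plane) : perp v 1 = v 0 := rfl
theorem prime_zero (w : EuclideanSpace ℝ (Fin 3)) : prime w 0 = w 0 := rfl
theorem prime_one (w : EuclideanSpace ℝ (Fin 3)) : prime w 1 = w 1 := rfl

theorem isWeakDeriv_nil {f : Plane → ℝ} (hf : LocallyIntegrable f) : IsWeakDeriv [] f f :=
  ⟨hf, hf, fun φ _ => by simp [classicalDeriv]⟩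

theorem memWHat_one_of_isWeakDeriv {f : Plane → ℝ} {g : Fin 2 → Plane → ℝ}
    (h : ∀ i, IsWeakDeriv [i] f (g i)) (hf : MemLpLoc 2 f) (hg : ∀ i, MemLp (g i) 2) :
    MemWHat 1 f := by
  refine ⟨⟨hf, fun α hα => ?_⟩, fun α hα => ?_⟩
  · match α, hα with
    | [], _ => exact ⟨f, isWeakDeriv_nil (h 0).locallyIntegrable_left, hf⟩
    | [i], _ => exact ⟨g i, h i, (hg i).memLpLoc⟩
    | _ :: _ :: _, hα => simp at hα
  · match α, hα with
    | [i], _ => exact (memLp_congr_ae (h i).weakDeriv_ae_eq).2 (hg i)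

theorem HallMHD.MemWLoc.isWeakDeriv_weakDeriv {m : ℕ} {s : ℝ≥0∞} {f : Plane → ℝ} (h : MemWLoc m s f)
    {α : List (Fin 2)} (hα : α.length ≤ m) : IsWeakDeriv α f (weakDeriv α f) :=
  let ⟨g, hg, _⟩ := h.2 α hα
  _root_.isWeakDeriv_weakDeriv ⟨g, hg⟩

theorem HallMHD.MemWLoc.memLpLoc_weakDeriv {m : ℕ} {s : ℝ≥0∞} {f : Plane → ℝ} (h : MemWLoc m s f)
    {α : List (Fin 2)} (hα : α.length ≤ m) : MemLpLoc s (weakDeriv α f) := by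
  obtain ⟨g, hg, hgs⟩ := h.2 α hα
  exact fun K hK => (memLp_congr_ae (ae_restrict_of_ae hg.weakDeriv_ae_eq)).2 (hgs K hK)

/-- The second equation of the system may be tested with a compactly supported `f ∈ W^{1,2}` for
which `∇Φ · ∇^⊥ f` is square integrable. -/
theorem HallMHD.IsStrongWeakSolution.weak_of_isWeakDeriv {h : Plane → EuclideanSpace ℝ (Fin 3)}
    (hh : ∀ i, MemLp (fun x => h x i) 2) {Φ Ψ : Plane → ℝ} (hsol : IsStrongWeakSolution h Φ Ψ)
    {f : Plane → ℝ} {g : Fin 2 → Plane → ℝ} (hf : ∀ i, IsWeakDeriv [i] f (g i))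
    (hfs : HasCompactSupport f) (hg : ∀ i, MemLp (g i) 2)
    (hG : MemLp (fun x => weakDeriv [1] Φ x * g 0 x - weakDeriv [0] Φ x * g 1 x) 2) :
    (∫ x, weakDeriv [0] Ψ x * g 0 x) + ∫ x, weakDeriv [1] Ψ x * g 1 x =
      -(∫ x, weakLaplacian Φ x * (weakDeriv [1] Φ x * g 0 x - weakDeriv [0] Φ x * g 1 x)) +
        ((∫ x, h x 1 * g 0 x) - ∫ x, h x 0 * g 1 x) := by
  have hΦ := hsol.mem_left
  have hb : ∀ j, IsWeakDeriv [j] Φ (weakDeriv [j] Φ) := fun j =>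
    hΦ.1.isWeakDeriv_weakDeriv (by simp)
  have hb2 : ∀ j, MemLpLoc 2 (weakDeriv [j] Φ) := fun j => hΦ.1.memLpLoc_weakDeriv (by simp)
  have hp : ∀ j, MemLp (weakDeriv [j] Ψ) 2 := fun j => hsol.mem_right.2 _ rfl
  have hA : MemLp (weakLaplacian Φ) 2 := (hΦ.2 [0, 0] rfl).add (hΦ.2 [1, 1] rfl)
  have hφ : ∀ n, IsTestFunction (mollify n f) := fun n =>
    ⟨mollify_contDiff n (hf 0).locallyIntegrable_left, mollify_hasCompactSupport n hfs⟩
  have hm : ∀ n i, MemLp (mollify n (g i)) 2 := fun n i => memLp_mollify n (hg i)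
  have hD : ∀ n, MemLp (fun x => weakDeriv [1] Φ x * mollify n (g 0) x -
      weakDeriv [0] Φ x * mollify n (g 1) x) 2 := fun n => by
    have : ∀ i j, MemLp (fun x => weakDeriv [j] Φ x * mollify n (g i) x) 2 := fun i j => by
      simp_rw [← fderiv_mollify n (hf i)]
      exact memLp_mul_testFunction (hb2 j) ((hφ n).fderiv_apply _)
    exact (this 0 1).sub (this 1 0)
  have heq : ∀ n, (∫ x, weakDeriv [0] Ψ x * mollify n (g 0) x) +
      (∫ x, weakDeriv [1] Ψ x * mollify n (g 1) x) =
      -(∫ x, weakLaplacian Φ x * (weakDeriv [1] Φ x * mollify n (g 0) x -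
        weakDeriv [0] Φ x * mollify n (g 1) x)) +
        ((∫ x, h x 1 * mollify n (g 0) x) - ∫ x, h x 0 * mollify n (g 1) x) := fun n => by
    have hw := hsol.weak _ (hφ n)
    simp only [inner_plane, gradient_apply_eq, weakGrad_zero, weakGrad_one, perp_zero, perp_one,
      prime_zero, prime_one, fderiv_mollify n (hf 0), fderiv_mollify n (hf 1)] at hw
    rw [integral_add ((hp 0).integrable_fun_mul (hm n 0)) ((hp 1).integrable_fun_mul (hm n 1))] at hw
    have hsub : Integrable fun x => h x 1 * mollify n (g 0) x - h x 0 * mollify n (g 1) x :=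
      ((hh 1).integrable_fun_mul (hm n 0)).sub ((hh 0).integrable_fun_mul (hm n 1))
    rw [hw, ← integral_neg, ← integral_sub ((hh 1).integrable_fun_mul (hm n 0))
      ((hh 0).integrable_fun_mul (hm n 1)), ← integral_add (hA.integrable_fun_mul (hD n)).fun_neg
      hsub]
    refine integral_congr_ae (ae_of_all _ fun x => ?_)
    ring
  have hlim : ∀ {a : Plane → ℝ}, MemLp a 2 → ∀ i, Tendsto (fun n => ∫ x, a x * mollify n (g i) x)
      atTop (𝓝 (∫ x, a x * g i x)) := fun ha i =>
    tendsto_integral_mul_of_tendsto_eLpNorm ha (hg i) (fun n => hm n i)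
      (tendsto_eLpNorm_mollify_sub (hg i))
  -- The commutator estimate is applied to the components of `∇Φ`, whose weak derivatives are the
  -- square integrable second derivatives of `Φ`.
  have hlimA := tendsto_integral_mul_of_tendsto_eLpNorm hA hG hD
    (tendsto_eLpNorm_cross_mollify_sub (b := fun j => weakDeriv [j] Φ)
      (b' := fun j i => weakDeriv [j, i] Φ)
      (fun j i => (hb j).fderiv_step (hΦ.1.isWeakDeriv_weakDeriv (by simp))) hb2
      (fun j i => hΦ.2 _ rfl) hg hG)
  refine tendsto_nhds_unique ((hlim (hp 0) 0).add (hlim (hp 1) 1)) ?_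
  simp_rw [heq]
  exact hlimA.neg.add ((hlim (hh 1) 0).sub (hlim (hh 0) 1))

/-! ### The local energy identity. -/

theorem lemma8p1 (h : Plane → EuclideanSpace ℝ (Fin 3)) (hh : MemLp h 2 volume)
    (Φ Ψ : Plane → ℝ) (hsol : IsStrongWeakSolution h Φ Ψ)
    (ζ : Plane → ℝ) (hζ : IsTestFunction ζ) (c : ℝ) :
    -- the weak gradient of `(Ψ - c) ζ` exists, and the three integrals below converge
    MemWHat 1 (fun y => (Ψ y - c) * ζ y) ∧
    Integrable (fun x => ((weakLaplacian Φ x) ^ 2 + ‖weakGrad Ψ x‖ ^ 2) * ζ x) ∧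
    Integrable (fun x => ⟪(Ψ x - c) • weakGrad Ψ x
      - ((Ψ x - c) * weakLaplacian Φ x) • perp (weakGrad Φ x), ∇ ζ x⟫) ∧
    Integrable (fun x => h x 2 * weakLaplacian Φ x * ζ x
      + ⟪prime (h x), perp (weakGrad (fun y => (Ψ y - c) * ζ y) x)⟫) ∧
    -- the local energy identity
    ∫ x, ((weakLaplacian Φ x) ^ 2 + ‖weakGrad Ψ x‖ ^ 2) * ζ x =
      -(∫ x, ⟪(Ψ x - c) • weakGrad Ψ x
          - ((Ψ x - c) * weakLaplacian Φ x) • perp (weakGrad Φ x), ∇ ζ x⟫)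
      + ∫ x, (h x 2 * weakLaplacian Φ x * ζ x
          + ⟪prime (h x), perp (weakGrad (fun y => (Ψ y - c) * ζ y) x)⟫) := by
  have hΦ := hsol.mem_left
  have hΨ := hsol.mem_right
  have hhi : ∀ i, MemLp (fun x => h x i) 2 := fun i =>
    (EuclideanSpace.proj (𝕜 := ℝ) i).comp_memLp' hh
  have hb : ∀ j, IsWeakDeriv [j] Φ (weakDeriv [j] Φ) := fun j =>
    hΦ.1.isWeakDeriv_weakDeriv (by simp)
  have hb2 : ∀ j, MemLpLoc 2 (weakDeriv [j] Φ) := fun j => hΦ.1.memLpLoc_weakDeriv (by simp)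
  have hp : ∀ j, MemLp (weakDeriv [j] Ψ) 2 := fun j => hΨ.2 _ rfl
  have hA : MemLp (weakLaplacian Φ) 2 := (hΦ.2 [0, 0] rfl).add (hΦ.2 [1, 1] rfl)
  have hq : ∀ i, IsWeakDeriv [i] (fun x => Ψ x - c) (weakDeriv [i] Ψ) := fun i =>
    (hΨ.1.isWeakDeriv_weakDeriv (by simp)).sub_const c
  have hq2 : MemLpLoc 2 (fun x => Ψ x - c) := fun K hK => by
    have : IsFiniteMeasure (volume.restrict K) := ⟨by simpa using hK.measure_lt_top⟩
    exact (hΨ.1.1 K hK).sub (memLp_const c)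
  set D : Fin 2 → Plane → ℝ := fun i x => fderiv ℝ ζ x (EuclideanSpace.single i 1) with hDdef
  have hD : ∀ i, IsTestFunction (D i) := fun i => hζ.fderiv_apply _
  set g : Fin 2 → Plane → ℝ := fun i x => weakDeriv [i] Ψ x * ζ x + (Ψ x - c) * D i x with hgdef
  have hf : ∀ i, IsWeakDeriv [i] (fun x => (Ψ x - c) * ζ x) (g i) := fun i =>
    (hq i).mul_testFunction hζ
  have hqD : ∀ i, MemLp (fun x => (Ψ x - c) * D i x) 2 := fun i => memLp_mul_testFunction hq2 (hD i)
  have hg : ∀ i, MemLp (g i) 2 := fun i =>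
    (memLp_mul_testFunction (hp i).memLpLoc hζ).add (hqD i)
  -- Both `Ψ - c` and `∂_jΦ` are locally `W^{1,2}`, so the Sobolev product estimate applies.
  have hqDb : ∀ i j, MemLp (fun x => (Ψ x - c) * D i x * weakDeriv [j] Φ x) 2 := fun i j =>
    memLp_mul_mul_testFunction hq
      (fun k => (hb j).fderiv_step (hΦ.1.isWeakDeriv_weakDeriv (α := [j, k]) (by simp))) hq2 (hb2 j)
      (fun k => (hp k).memLpLoc) (fun k => (hΦ.2 [j, k] rfl).memLpLoc) (hD i)
  have hAζ := memLp_mul_testFunction hA.memLpLoc hζ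
  have hstrong := hsol.strong
  simp only [inner_plane, weakGrad_zero, weakGrad_one, perp_zero, perp_one] at hstrong
  -- The first equation replaces the cross term of `∇Φ` and `∇Ψ`, which makes the next claim, square
  -- integrability, possible.
  have hGeq : (fun x => weakDeriv [1] Φ x * g 0 x - weakDeriv [0] Φ x * g 1 x) =ᵐ[volume]
      fun x => (weakLaplacian Φ x * ζ x - h x 2 * ζ x) +
        ((Ψ x - c) * D 0 x * weakDeriv [1] Φ x - (Ψ x - c) * D 1 x * weakDeriv [0] Φ x) := by
    filter_upwards [hstrong] with x hx
    rw [hx]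
    simp only [hgdef]
    ring
  have hG : MemLp (fun x => weakDeriv [1] Φ x * g 0 x - weakDeriv [0] Φ x * g 1 x) 2 :=
    (memLp_congr_ae hGeq).2 ((hAζ.sub (memLp_mul_testFunction (hhi 2).memLpLoc hζ)).add
      ((hqDb 0 1).sub (hqDb 1 0)))
  have hweak := hsol.weak_of_isWeakDeriv hhi hf hζ.2.mul_left hg hG
  have e1 : (fun x => ((weakLaplacian Φ x) ^ 2 + ‖weakGrad Ψ x‖ ^ 2) * ζ x) = fun x =>
      weakLaplacian Φ x * (weakLaplacian Φ x * ζ x) +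
        (weakDeriv [0] Ψ x * (weakDeriv [0] Ψ x * ζ x) +
          weakDeriv [1] Ψ x * (weakDeriv [1] Ψ x * ζ x)) := by
    funext x
    rw [EuclideanSpace.real_norm_sq_eq, Fin.sum_univ_two, weakGrad_zero, weakGrad_one]
    ring
  have e2 : (fun x => ⟪(Ψ x - c) • weakGrad Ψ x
      - ((Ψ x - c) * weakLaplacian Φ x) • perp (weakGrad Φ x), ∇ ζ x⟫) = fun x =>
      (weakDeriv [0] Ψ x * ((Ψ x - c) * D 0 x) + weakDeriv [1] Ψ x * ((Ψ x - c) * D 1 x)) +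
      weakLaplacian Φ x * ((Ψ x - c) * D 0 x * weakDeriv [1] Φ x -
        (Ψ x - c) * D 1 x * weakDeriv [0] Φ x) := by
    funext x
    simp only [inner_plane, gradient_apply_eq, PiLp.sub_apply, PiLp.smul_apply, weakGrad_zero,
      weakGrad_one, perp_zero, perp_one, smul_eq_mul, hDdef]
    ring
  have e3 : (fun x => h x 2 * weakLaplacian Φ x * ζ x
      + ⟪prime (h x), perp (weakGrad (fun y => (Ψ y - c) * ζ y) x)⟫) =ᵐ[volume] fun x =>
      h x 2 * (weakLaplacian Φ x * ζ x) + (h x 1 * g 0 x - h x 0 * g 1 x) := by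
    filter_upwards [(hf 0).weakDeriv_ae_eq, (hf 1).weakDeriv_ae_eq] with x h0 h1
    simp only [inner_plane, weakGrad_zero, weakGrad_one, perp_zero, perp_one, prime_zero,
      prime_one, h0, h1]
    ring
  have hpζ : ∀ i, MemLp (fun x => weakDeriv [i] Ψ x * ζ x) 2 := fun i =>
    memLp_mul_testFunction (hp i).memLpLoc hζ
  have i1 : Integrable fun x => ((weakLaplacian Φ x) ^ 2 + ‖weakGrad Ψ x‖ ^ 2) * ζ x := by
    rw [e1]
    exact (hA.integrable_fun_mul hAζ).add
      (((hp 0).integrable_fun_mul (hpζ 0)).add ((hp 1).integrable_fun_mul (hpζ 1)))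
  have i2 : Integrable fun x => ⟪(Ψ x - c) • weakGrad Ψ x
      - ((Ψ x - c) * weakLaplacian Φ x) • perp (weakGrad Φ x), ∇ ζ x⟫ := by
    rw [e2]
    exact (((hp 0).integrable_fun_mul (hqD 0)).add ((hp 1).integrable_fun_mul (hqD 1))).add
      (hA.integrable_fun_mul ((hqDb 0 1).sub (hqDb 1 0)))
  have j0 := (hhi 2).integrable_fun_mul hAζ
  have j1 := (hhi 1).integrable_fun_mul (hg 0)
  have j2 := (hhi 0).integrable_fun_mul (hg 1)
  have j12 : Integrable fun x => h x 1 * g 0 x - h x 0 * g 1 x := j1.sub j2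
  have i3 := (integrable_congr e3).2 (j0.add j12)
  refine ⟨memWHat_one_of_isWeakDeriv hf (memLp_mul_testFunction hq2 hζ).memLpLoc hg,
    i1, i2, i3, ?_⟩
  have k0 := (hp 0).integrable_fun_mul (hg 0)
  have k1 := (hp 1).integrable_fun_mul (hg 1)
  have kA := hA.integrable_fun_mul hG
  -- Multiplying the formula for the cross term by `ΔΦ` produces `(ΔΦ)² ζ`, the flux term and `-h³
  -- ΔΦ ζ`; the last is compensated on the right. Then `hweak` evaluates the bracket.
  have hsum : (∫ x, ((weakLaplacian Φ x) ^ 2 + ‖weakGrad Ψ x‖ ^ 2) * ζ x) +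
      (∫ x, ⟪(Ψ x - c) • weakGrad Ψ x
        - ((Ψ x - c) * weakLaplacian Φ x) • perp (weakGrad Φ x), ∇ ζ x⟫) =
      (((∫ x, weakDeriv [0] Ψ x * g 0 x) + ∫ x, weakDeriv [1] Ψ x * g 1 x) +
        ∫ x, weakLaplacian Φ x * (weakDeriv [1] Φ x * g 0 x - weakDeriv [0] Φ x * g 1 x)) +
        ∫ x, h x 2 * (weakLaplacian Φ x * ζ x) := by
    rw [← integral_add i1 i2, ← integral_add k0 k1, ← integral_add (k0.fun_add k1) kA,
      ← integral_add ((k0.fun_add k1).fun_add kA) j0]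
    refine integral_congr_ae ?_
    filter_upwards [hGeq] with x hx
    have e1x := congrFun e1 x
    have e2x := congrFun e2 x
    beta_reduce at e1x e2x
    rw [e1x, e2x, hx]
    simp only [hgdef]
    ring
  have h3 : ∫ x, (h x 2 * weakLaplacian Φ x * ζ x
      + ⟪prime (h x), perp (weakGrad (fun y => (Ψ y - c) * ζ y) x)⟫) =
      (∫ x, h x 2 * (weakLaplacian Φ x * ζ x)) +
        ((∫ x, h x 1 * g 0 x) - ∫ x, h x 0 * g 1 x) := by
    rw [integral_congr_ae e3, ← integral_sub j1 j2, ← integral_add j0 j12]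
  rw [h3]
  linarith
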